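/- Conventions. For a topological space $X$, a continuous valuation on $X$ is a map $\mu$ from the open subsets of $X$ to $[0,\infty]$ that satisfies $\mu(\emptyset)=0$, is monotone, satisfies $\mu(U)+\mu(V)=\mu(U\cup V)+\mu(U\cap V)$, and preserves directed unions: $\mu(\bigcup_i U_i)=\sup_i\mu(U_i)$. Let $\mathcal V_wX$ be the set of continuous valuations on $X$ with the weak topology, generated by the sets $[U>r]=\{\mu\mid \mu(U)>r\}$ ($U$ open, $r\ge 0$), and with pointwise addition and multiplication by $r\in\mathbb R_+=[0,\infty)$. For lower semicontinuous $h\colon X\to[0,\infty]$ let $\int h\,d\mu=\int_0^\infty\mu(h^{-1}(r,\infty])\,dr$. The functor $\mathcal V_w$, acting on continuous maps by $\mathcal V_wf(\mu)(V)=\mu(f^{-1}(V))$, is a monad on the category $\mathbf{TOP}_0$ of $T_0$ spaces and continuous maps, with unit $x\mapsto\delta_x$ (Dirac mass) and multiplication $m_X(\varpi)(U)=\int_{\nu\in\mathcal V_wX}\nu(U)\,d\varpi$; this is the extended probabilistic powerdomain monad. A cone is a commutative monoid $(C,+,0)$ with a scalar multiplication $\mathbb R_+\times C\to C$ satisfying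 $r(x+y)=rx+ry$, $(r+s)x=rx+sx$, $(rs)x=r(sx)$, $1x=x$, $0x=0$, $r0=0$. A topological cone is a cone with a $T_0$ topology making $+$ and $\cdot$ jointly continuous, where $\mathbb R_+$ carries the Scott topology. A map $f$ between cones is linear if $f(rx+sy)=rf(x)+sf(y)$ for all $r,s\in\mathbb R_+$. A set $A\subseteq C$ is convex if $ra+(1-r)b\in A$ for $a,b\in A$, $r\in[0,1]$, and is a half-space if $A$ and its complement are convex. $C$ is weakly locally convex if every open neighbourhood of every point contains a convex (not necessarily open) neighbourhood of that point, and locally linear if it has a subbase of open half-spaces. A space is sober if every irreducible closed subset is the closure of a unique point. A linear retraction between topological cones is a continuous linear map that has a continuous (not necessarily linear) section. Proposition. Let $(X,\alpha)$ be an Eilenberg–Moore algebra of the monad $\mathcal V_w$ on $\mathbf{TOP}_0$. Then there is a cone structure on $X$ with $$x+y=\alpha(\delta_x+\delta_y),\qquad r\cdot x=\alpha(r\delta_x)\qquad(x,y\in X,\ r\in\mathbb R_+),$$ and with this structure $X$ is a weakly locally convex, sober topological cone and $\alpha\colon\mathcal V_wX\to X$ is linear. Moreover $\mathcal V_wX$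 is a locally linear, sober topological cone and $\alpha$ is a linear retraction, so that $X$ is a linear retract of $\mathcal V_wX$. -/

import Mathlib

open CategoryTheory TopologicalSpace MeasureTheory
open scoped NNReal ENNReal Topology

universe u

namespace ProbPowerdomain

noncomputable section

/-! ### Continuous valuations and the weak topology -/

/-- A continuous valuation on a topological space. -/
@[ext]
structure ContValuation (X : Type u) [TopologicalSpace X] where
  toFun : Opens X → ℝ≥0∞
  strict : toFun ⊥ = 0
  mono : ∀ U V : Opens X, U ≤ V → toFun U ≤ toFun V
  modular : ∀ U V : Opens X, toFun U + toFun V = toFun (U ⊔ V) + toFun (U ⊓ V)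
  scott : ScottContinuous toFun

variable {X Y Z : Type u} [TopologicalSpace X] [TopologicalSpace Y] [TopologicalSpace Z]

instance : FunLike (ContValuation X) (Opens X) ℝ≥0∞ where
  coe := ContValuation.toFun
  coe_injective _ _ h := ContValuation.ext h

lemma ContValuation.ext_opens {μ ν : ContValuation X} (h : ∀ U, μ U = ν U) : μ = ν :=
  DFunLike.ext _ _ h

/-- The weak topology, generated by the sets `[U > r] = {μ | μ U > r}`. -/
instance : TopologicalSpace (ContValuation X) :=
  TopologicalSpace.generateFrom
    {S | ∃ (U : Opens X) (r : ℝ≥0), S = {μ : ContValuation X | (r : ℝ≥0∞) < μ U}}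

lemma ContValuation.apply_bot (μ : ContValuation X) : μ ⊥ = 0 := μ.strict

lemma ContValuation.monotone (μ : ContValuation X) : Monotone μ := fun U V h => μ.mono U V h

lemma ContValuation.map_iSup (μ : ContValuation X) {ι : Type*} [Nonempty ι] (U : ι → Opens X)
    (hU : Directed (· ≤ ·) U) : μ (⨆ i, U i) = ⨆ i, μ (U i) := by
  have h := μ.scott (d := Set.range U) (Set.range_nonempty U) hU.directedOn_range
    (a := ⨆ i, U i) isLUB_iSup
  rw [← Set.range_comp] at h
  exact h.iSup_eq.symm

/-- Reduces Scott continuity to suprema of directed families. -/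
lemma scottContinuous_of_iSup {f : Opens X → ℝ≥0∞} (hm : Monotone f)
    (h : ∀ (d : Set (Opens X)), Nonempty d → Directed (· ≤ ·) (fun i : d => (i : Opens X)) →
      f (⨆ i : d, (i : Opens X)) ≤ ⨆ i : d, f i) : ScottContinuous f := by
  intro d hd hd' a ha
  have hne : Nonempty d := hd.to_subtype
  have ha' : a = ⨆ i : d, (i : Opens X) := by
    rw [← sSup_eq_iSup']; exact ha.sSup_eq.symm
  refine ⟨?_, ?_⟩
  · rintro _ ⟨U, hU, rfl⟩
    exact hm (ha.1 hU)
  · intro b hb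
    rw [ha']
    exact (h d hne hd'.directed_val).trans (iSup_le fun i => hb ⟨i, i.2, rfl⟩)

instance : T0Space (ContValuation X) := by
  refine ⟨fun μ ν h => ?_⟩
  have key : ∀ (μ ν : ContValuation X), Inseparable μ ν → ∀ U, μ U ≤ ν U := by
    intro μ ν h U
    refine ENNReal.le_of_forall_nnreal_lt fun r hr => ?_
    have ho : IsOpen {ρ : ContValuation X | (r : ℝ≥0∞) < ρ U} := .basic _ ⟨U, r, rfl⟩
    exact le_of_lt ((h.mem_open_iff ho).1 hr)
  exact ContValuation.ext_opens fun U => le_antisymm (key μ ν h U) (key ν μ h.symm U)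

lemma lowerSemicontinuous_eval (U : Opens X) :
    LowerSemicontinuous (fun μ : ContValuation X => μ U) := by
  rw [lowerSemicontinuous_iff_isOpen_preimage]
  intro a
  induction a with
  | top => simp
  | coe r => exact .basic _ ⟨U, r, rfl⟩

lemma continuous_of_lowerSemicontinuous {f : X → ContValuation Y}
    (h : ∀ U, LowerSemicontinuous (fun x => f x U)) : Continuous f := by
  refine continuous_generateFrom_iff.2 ?_
  rintro _ ⟨U, r, rfl⟩
  exact (h U).isOpen_preimage r

/-! ### Cone structure -/

instance : Zero (ContValuation X) where
  zero :=
    { toFun := fun _ => 0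
      strict := rfl
      mono := fun _ _ _ => le_rfl
      modular := fun _ _ => rfl
      scott := scottContinuous_of_iSup (fun _ _ _ => le_rfl) (fun _ _ _ => zero_le) }

instance : Add (ContValuation X) where
  add μ ν :=
    { toFun := fun U => μ U + ν U
      strict := by
        change μ.toFun ⊥ + ν.toFun ⊥ = 0
        rw [μ.strict, ν.strict, add_zero]
      mono := fun U V h => add_le_add (μ.mono U V h) (ν.mono U V h)
      modular := fun U V => by
        have h1 : μ U + μ V = μ (U ⊔ V) + μ (U ⊓ V) := μ.modular U V
        have h2 : ν U + ν V = ν (U ⊔ V) + ν (U ⊓ V) := ν.modular U V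
        rw [add_add_add_comm, h1, h2, add_add_add_comm]
      scott := by
        refine scottContinuous_of_iSup
          (fun U V h => add_le_add (μ.mono U V h) (ν.mono U V h)) ?_
        intro d hd hd'
        rw [μ.map_iSup _ hd', ν.map_iSup _ hd']
        refine le_of_eq (ENNReal.iSup_add_iSup fun i j => ?_)
        obtain ⟨k, hi, hj⟩ := hd' i j
        exact ⟨k, add_le_add (μ.monotone hi) (ν.monotone hj)⟩ }

instance : SMul ℝ≥0 (ContValuation X) where
  smul r μ :=
    { toFun := fun U => (r : ℝ≥0∞) * μ U
      strict := by
        change (r : ℝ≥0∞) * μ.toFun ⊥ = 0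
        rw [μ.strict, mul_zero]
      mono := fun U V h => mul_le_mul_right (μ.mono U V h) _
      modular := fun U V => by
        have h1 : μ U + μ V = μ (U ⊔ V) + μ (U ⊓ V) := μ.modular U V
        rw [← mul_add, h1, mul_add]
      scott := by
        refine scottContinuous_of_iSup (fun U V h => mul_le_mul_right (μ.mono U V h) _) ?_
        intro d hd hd'
        rw [μ.map_iSup _ hd', ENNReal.mul_iSup] }

@[simp] lemma ContValuation.zero_apply (U : Opens X) : (0 : ContValuation X) U = 0 := rfl

@[simp] lemma ContValuation.add_apply (μ ν : ContValuation X) (U : Opens X) :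
    (μ + ν) U = μ U + ν U := rfl

@[simp] lemma ContValuation.smul_apply (r : ℝ≥0) (μ : ContValuation X) (U : Opens X) :
    (r • μ) U = r * μ U := rfl

instance : AddCommMonoid (ContValuation X) where
  add_assoc _ _ _ := ContValuation.ext_opens fun _ => by simp [add_assoc]
  zero_add _ := ContValuation.ext_opens fun _ => by simp
  add_zero _ := ContValuation.ext_opens fun _ => by simp
  add_comm _ _ := ContValuation.ext_opens fun _ => by simp [add_comm]
  nsmul := nsmulRec

instance : Module ℝ≥0 (ContValuation X) where
  one_smul _ := ContValuation.ext_opens fun _ => by simp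
  mul_smul _ _ _ := ContValuation.ext_opens fun _ => by simp [mul_assoc]
  smul_zero _ := ContValuation.ext_opens fun _ => by simp
  smul_add _ _ _ := ContValuation.ext_opens fun _ => by simp [mul_add]
  add_smul _ _ _ := ContValuation.ext_opens fun _ => by simp [add_mul]
  zero_smul _ := ContValuation.ext_opens fun _ => by simp

/-! ### Dirac valuations and functoriality -/

open Classical in
/-- The Dirac mass at `x`. -/
def dirac (x : X) : ContValuation X where
  toFun U := if x ∈ U then 1 else 0
  strict := by simp
  mono U V h := by
    split_ifs with h1 h2
    · exact le_rfl
    · exact absurd (h h1) h2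
    · exact zero_le
    · exact le_rfl
  modular U V := by
    by_cases h1 : x ∈ U <;> by_cases h2 : x ∈ V <;> simp [h1, h2]
  scott := by
    refine scottContinuous_of_iSup ?_ ?_
    · intro U V h
      dsimp only
      split_ifs with h1 h2
      · exact le_rfl
      · exact absurd (h h1) h2
      · exact zero_le
      · exact le_rfl
    · intro d hd hd'
      split_ifs with h1
      · obtain ⟨i, hi⟩ := Opens.mem_iSup.1 h1
        exact le_iSup_of_le i (by simp [hi])
      · exact zero_le

open Classical in
lemma dirac_apply (x : X) (U : Opens X) : dirac x U = if x ∈ U then 1 else 0 := rfl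

/-- The push-forward `V f`. -/
def map (f : C(X, Y)) (μ : ContValuation X) : ContValuation Y where
  toFun V := μ (V.comap f)
  strict := μ.strict
  mono _ _ h := μ.mono _ _ (Opens.comap_mono f h)
  modular U V := μ.modular (U.comap f) (V.comap f)
  scott := by
    refine scottContinuous_of_iSup (fun U V h => μ.monotone (Opens.comap_mono f h)) ?_
    intro d hd hd'
    have h1 : Directed (· ≤ ·) (fun i : d => Opens.comap f (i : Opens Y)) :=
      fun i j => (hd' i j).imp fun _ hk =>
        ⟨Opens.comap_mono f hk.1, Opens.comap_mono f hk.2⟩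
    rw [← μ.map_iSup _ h1]
    refine μ.monotone fun x hx => ?_
    obtain ⟨i, hi⟩ := Opens.mem_iSup.1 (show f x ∈ ⨆ i : d, (i : Opens Y) from hx)
    exact Opens.mem_iSup.2 ⟨i, hi⟩

lemma map_apply (f : C(X, Y)) (μ : ContValuation X) (V : Opens Y) :
    map f μ V = μ (V.comap f) := rfl

/-! ### The Choquet integral -/

/-- The open set `h⁻¹ (r, ∞]` for a lower semicontinuous `h`. -/
def level (h : X → ℝ≥0∞) (hh : LowerSemicontinuous h) (r : ℝ) : Opens X :=
  ⟨{x | ENNReal.ofReal r < h x}, hh.isOpen_preimage _⟩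

lemma mem_level (h : X → ℝ≥0∞) (hh : LowerSemicontinuous h) (r : ℝ) (x : X) :
    x ∈ level h hh r ↔ ENNReal.ofReal r < h x := Iff.rfl

/-- `∫ h dμ = ∫₀^∞ μ (h⁻¹ (r, ∞]) dr`. The integrand is antitone in `r`, so this Lebesgue integral is
the (improper) Riemann integral. -/
def integral (μ : ContValuation X) (h : X → ℝ≥0∞) (hh : LowerSemicontinuous h) : ℝ≥0∞ :=
  ∫⁻ r in Set.Ioi (0 : ℝ), μ (level h hh r)

/-- Dyadic lower sums. -/
def lowerSum (F : ℝ → ℝ≥0∞) (N : ℕ) : ℝ≥0∞ :=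
  (2⁻¹ : ℝ≥0∞) ^ N * ∑ k ∈ Finset.range (N * 2 ^ N), F (((k : ℝ) + 1) / 2 ^ N)

lemma lowerSum_mono {F : ℝ → ℝ≥0∞} (hF : Antitone F) : Monotone (lowerSum F) := by
  refine monotone_nat_of_le_succ fun N => ?_
  unfold lowerSum
  have h1 : ∀ n : ℕ, ∑ k ∈ Finset.range n, F (((k : ℝ) + 1) / 2 ^ N) ≤
      2⁻¹ * ∑ k ∈ Finset.range (n * 2), F (((k : ℝ) + 1) / 2 ^ (N + 1)) := by
    intro n
    induction n with
    | zero => simp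
    | succ n ih =>
      rw [Finset.sum_range_succ, show (n + 1) * 2 = n * 2 + 1 + 1 by ring,
        Finset.sum_range_succ, Finset.sum_range_succ, add_assoc, mul_add]
      refine add_le_add ih ?_
      have e2 : F (((n : ℝ) + 1) / 2 ^ N) ≤ F ((((n * 2 : ℕ) : ℝ) + 1) / 2 ^ (N + 1)) := by
        apply hF
        rw [pow_succ, div_le_div_iff₀ (by positivity) (by positivity)]
        push_cast
        have : (0 : ℝ) < 2 ^ N := by positivity
        nlinarith
      have e3 : F (((n : ℝ) + 1) / 2 ^ N) ≤ F ((((n * 2 + 1 : ℕ) : ℝ) + 1) / 2 ^ (N + 1)) := by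
        apply hF
        rw [pow_succ, div_le_div_iff₀ (by positivity) (by positivity)]
        push_cast
        have : (0 : ℝ) < 2 ^ N := by positivity
        nlinarith
      calc F (((n : ℝ) + 1) / 2 ^ N)
          = 2⁻¹ * (F (((n : ℝ) + 1) / 2 ^ N) + F (((n : ℝ) + 1) / 2 ^ N)) := by
            rw [← two_mul, ← mul_assoc, ENNReal.inv_mul_cancel (by simp) (by simp), one_mul]
        _ ≤ _ := by gcongr
  calc _ ≤ (2⁻¹ : ℝ≥0∞) ^ N * (2⁻¹ * ∑ k ∈ Finset.range (N * 2 ^ N * 2),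
        F (((k : ℝ) + 1) / 2 ^ (N + 1))) := by gcongr; exact h1 _
    _ ≤ _ := by
      rw [← mul_assoc, ← pow_succ]
      refine mul_le_mul_right (Finset.sum_le_sum_of_subset (Finset.range_mono ?_)) _
      rw [pow_succ, ← mul_assoc]
      gcongr
      omega

lemma iSup_lowerSum {F : ℝ → ℝ≥0∞} (hF : Antitone F)
    (hr : ∀ r > 0, ∀ a < F r, ∃ s > r, a < F s) :
    ⨆ N, lowerSum F N = ∫⁻ r in Set.Ioi (0 : ℝ), F r := by
  set f : ℕ → ℝ → ℝ≥0∞ := fun N r => ∑ k ∈ Finset.range (N * 2 ^ N),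
    (Set.Ico ((k : ℝ) / 2 ^ N) (((k : ℝ) + 1) / 2 ^ N)).indicator
      (fun _ => F (((k : ℝ) + 1) / 2 ^ N)) r with hf
  have hmeas : ∀ N, Measurable (f N) := fun N =>
    Finset.measurable_sum _ fun k _ => measurable_const.indicator measurableSet_Ico
  -- value of the step function on the dyadic interval
  have hval : ∀ N : ℕ, ∀ r : ℝ, 0 < r → r < N →
      f N r = F (((⌊r * 2 ^ N⌋₊ : ℝ) + 1) / 2 ^ N) := by
    intro N r h0 hN
    have hp : (0 : ℝ) < 2 ^ N := by positivity
    have hk := Nat.floor_le (show 0 ≤ r * 2 ^ N by positivity)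
    have hk' := Nat.lt_floor_add_one (r * 2 ^ N)
    rw [hf]
    dsimp only
    rw [Finset.sum_eq_single ⌊r * 2 ^ N⌋₊]
    · rw [Set.indicator_of_mem]
      exact ⟨by rwa [div_le_iff₀ hp], by rwa [lt_div_iff₀ hp]⟩
    · intro b _ hb
      rw [Set.indicator_of_notMem]
      rintro ⟨h1, h2⟩
      rw [div_le_iff₀ hp] at h1
      rw [lt_div_iff₀ hp] at h2
      exact hb ((Nat.floor_eq_iff (by positivity)).2 ⟨h1, h2⟩).symm
    · intro hn
      exfalso
      apply hn
      rw [Finset.mem_range, Nat.floor_lt (by positivity)]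
      push_cast
      gcongr
  have hzero : ∀ N : ℕ, ∀ r : ℝ, (N : ℝ) ≤ r → f N r = 0 := by
    intro N r h
    have hp : (0 : ℝ) < 2 ^ N := by positivity
    refine Finset.sum_eq_zero fun k hk => ?_
    rw [Set.indicator_of_notMem]
    rintro ⟨-, h2⟩
    rw [lt_div_iff₀ hp] at h2
    have h3 : ((k + 1 : ℕ) : ℝ) ≤ ((N * 2 ^ N : ℕ) : ℝ) := by
      exact_mod_cast Finset.mem_range.1 hk
    push_cast at h3
    nlinarith
  have hint : ∀ N, ∫⁻ r in Set.Ioi (0 : ℝ), f N r = lowerSum F N := by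
    intro N
    have hp : (0 : ℝ) < 2 ^ N := by positivity
    rw [hf, setLIntegral_congr (Ioi_ae_eq_Ici (μ := volume) (a := (0 : ℝ)))]
    dsimp only
    rw [lintegral_finsetSum _ fun k _ => measurable_const.indicator measurableSet_Ico]
    unfold lowerSum
    rw [Finset.mul_sum]
    refine Finset.sum_congr rfl fun k _ => ?_
    rw [lintegral_indicator measurableSet_Ico, lintegral_const, Measure.restrict_apply_univ,
      Measure.restrict_apply measurableSet_Ico, Set.inter_eq_left.2, Real.volume_Ico, mul_comm]
    · congr 1
      rw [← sub_div, add_sub_cancel_left, ENNReal.ofReal_div_of_pos hp, ENNReal.ofReal_one,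
        ENNReal.ofReal_pow (by norm_num), ENNReal.ofReal_ofNat, one_div, ENNReal.inv_pow]
    · intro r hr
      exact le_trans (by positivity) hr.1
  apply le_antisymm
  · refine iSup_le fun N => ?_
    rw [← hint]
    refine setLIntegral_mono' measurableSet_Ioi fun r h0 => ?_
    rcases lt_or_ge r N with h | h
    · rw [hval N r h0 h]
      refine hF ?_
      rw [le_div_iff₀ (by positivity)]
      exact (Nat.lt_floor_add_one _).le
    · rw [hzero N r h]; exact zero_le
  · calc ∫⁻ r in Set.Ioi (0 : ℝ), F r
        ≤ ∫⁻ r in Set.Ioi (0 : ℝ), Filter.liminf (fun N => f N r) Filter.atTop := by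
          refine setLIntegral_mono' measurableSet_Ioi fun r h0 => ?_
          refine le_of_forall_lt fun a ha => ?_
          obtain ⟨b, hab, hb⟩ := exists_between ha
          refine lt_of_lt_of_le hab (Filter.le_liminf_of_le (by isBoundedDefault) ?_)
          obtain ⟨s, hs, hbs⟩ := hr r h0 b hb
          obtain ⟨n, hn⟩ := exists_nat_gt r
          obtain ⟨m, hm⟩ := exists_pow_lt_of_lt_one (sub_pos.2 hs)
            (show (2⁻¹ : ℝ) < 1 by norm_num)
          filter_upwards [Filter.eventually_ge_atTop n, Filter.eventually_ge_atTop m] with N hN hM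
          have hp : (0 : ℝ) < 2 ^ N := by positivity
          rw [hval N r h0 (hn.trans_le (by exact_mod_cast hN))]
          refine hbs.le.trans (hF ?_)
          have h4 : (2⁻¹ : ℝ) ^ N ≤ 2⁻¹ ^ m :=
            pow_le_pow_of_le_one (by norm_num) (by norm_num) hM
          have h5 := Nat.floor_le (show 0 ≤ r * 2 ^ N from by have : (0:ℝ) < r := h0; positivity)
          rw [div_le_iff₀ hp]
          have h6 : (2⁻¹ : ℝ) ^ N * 2 ^ N = 1 := by rw [← mul_pow]; norm_num
          nlinarith
      _ ≤ Filter.liminf (fun N => ∫⁻ r in Set.Ioi (0 : ℝ), f N r) Filter.atTop :=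
          lintegral_liminf_le hmeas
      _ ≤ ⨆ N, lowerSum F N := by
          simp_rw [hint]
          refine Filter.liminf_le_of_le (by isBoundedDefault) fun b hb => ?_
          obtain ⟨N, hN⟩ := hb.exists
          exact hN.trans (le_iSup _ N)

lemma level_antitone (h : X → ℝ≥0∞) (hh : LowerSemicontinuous h) : Antitone (level h hh) :=
  fun _ _ hrs _ hx => lt_of_le_of_lt (ENNReal.ofReal_le_ofReal hrs) hx

lemma apply_level_antitone (μ : ContValuation X) (h : X → ℝ≥0∞) (hh : LowerSemicontinuous h) :
    Antitone (fun r => μ (level h hh r)) :=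
  fun _ _ hrs => μ.monotone (level_antitone h hh hrs)

lemma apply_level_right (μ : ContValuation X) (h : X → ℝ≥0∞) (hh : LowerSemicontinuous h) :
    ∀ r > 0, ∀ a < μ (level h hh r), ∃ s > r, a < μ (level h hh s) := by
  intro r hr a ha
  have hle : level h hh r ≤ ⨆ n : ℕ, level h hh (r + 1 / ((n : ℝ) + 1)) := by
    intro x hx
    obtain ⟨s, hs1, hs2⟩ := ENNReal.lt_iff_exists_nnreal_btwn.1 (show ENNReal.ofReal r < h x from hx)
    have hs3 : r < s := by
      rw [← ENNReal.ofReal_coe_nnreal] at hs1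
      exact (ENNReal.ofReal_lt_ofReal_iff_of_nonneg hr.le).1 hs1
    obtain ⟨n, hn⟩ := exists_nat_one_div_lt (sub_pos.2 hs3)
    refine Opens.mem_iSup.2 ⟨n, lt_of_le_of_lt ?_ hs2⟩
    rw [← ENNReal.ofReal_coe_nnreal]
    exact ENNReal.ofReal_le_ofReal (by linarith)
  have hmono : Monotone (fun n : ℕ => level h hh (r + 1 / ((n : ℝ) + 1))) := by
    intro m n hmn
    refine level_antitone h hh ?_
    gcongr
  have h2 := lt_of_lt_of_le ha (μ.monotone hle)
  rw [μ.map_iSup _ hmono.directed_le] at h2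
  obtain ⟨n, hn⟩ := lt_iSup_iff.1 h2
  exact ⟨_, by simp; positivity, hn⟩

lemma integral_eq_iSup (μ : ContValuation X) (h : X → ℝ≥0∞) (hh : LowerSemicontinuous h) :
    integral μ h hh = ⨆ N, lowerSum (fun r => μ (level h hh r)) N :=
  (iSup_lowerSum (apply_level_antitone μ h hh) (apply_level_right μ h hh)).symm

lemma integral_congr {μ : ContValuation X} {h k : X → ℝ≥0∞} {hh : LowerSemicontinuous h}
    (hk : LowerSemicontinuous k) (e : ∀ x, h x = k x) : integral μ h hh = integral μ k hk := by
  obtain rfl : h = k := funext e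
  rfl

lemma integral_mono (μ : ContValuation X) {h k : X → ℝ≥0∞} {hh : LowerSemicontinuous h}
    {hk : LowerSemicontinuous k} (e : ∀ x, h x ≤ k x) : integral μ h hh ≤ integral μ k hk :=
  lintegral_mono fun _ => μ.monotone fun x (hx : _ < _) => lt_of_lt_of_le hx (e x)

lemma integral_iSup (μ : ContValuation X) {ι : Type*} [Nonempty ι] (h : ι → X → ℝ≥0∞)
    (hh : ∀ i, LowerSemicontinuous (h i)) (hd : Directed (· ≤ ·) h)
    (hs : LowerSemicontinuous (fun x => ⨆ i, h i x)) :
    integral μ (fun x => ⨆ i, h i x) hs = ⨆ i, integral μ (h i) (hh i) := by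
  simp_rw [integral_eq_iSup]
  rw [iSup_comm]
  refine iSup_congr fun N => ?_
  unfold lowerSum
  rw [← ENNReal.mul_iSup]
  congr 1
  have hl : ∀ r, Directed (· ≤ ·) (fun i => level (h i) (hh i) r) := fun r i j =>
    (hd i j).imp fun k hk => ⟨fun x (hx : _ < _) => lt_of_lt_of_le hx (hk.1 x),
      fun x (hx : _ < _) => lt_of_lt_of_le hx (hk.2 x)⟩
  have he : ∀ r, level (fun x => ⨆ i, h i x) hs r = ⨆ i, level (h i) (hh i) r := by
    intro r
    ext x
    simp [mem_level, lt_iSup_iff]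
  simp_rw [he, fun r => μ.map_iSup _ (hl r)]
  refine ENNReal.finsetSum_iSup fun i j => ?_
  obtain ⟨k, hk⟩ := hd i j
  exact ⟨k, fun a => ⟨μ.monotone fun x (hx : _ < _) => lt_of_lt_of_le hx (hk.1 x),
    μ.monotone fun x (hx : _ < _) => lt_of_lt_of_le hx (hk.2 x)⟩⟩

lemma integral_dirac (x : X) (h : X → ℝ≥0∞) (hh : LowerSemicontinuous h) :
    integral (dirac x) h hh = h x := by
  classical
  unfold integral
  have e : ∀ r : ℝ, dirac x (level h hh r) =
      {r : ℝ | ENNReal.ofReal r < h x}.indicator (fun _ => 1) r := by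
    intro r
    rw [dirac_apply, Set.indicator_apply]
    congr
  have hm : MeasurableSet {r : ℝ | ENNReal.ofReal r < h x} :=
    measurableSet_lt ENNReal.measurable_ofReal measurable_const
  simp_rw [e]
  rw [lintegral_indicator hm, lintegral_const, Measure.restrict_apply_univ,
    Measure.restrict_apply hm, one_mul]
  rcases eq_or_ne (h x) ∞ with hx | hx
  · simp [hx]
  · have : {r : ℝ | ENNReal.ofReal r < h x} ∩ Set.Ioi 0 = Set.Ioo 0 (h x).toReal := by
      ext r
      refine and_comm.trans (and_congr_right fun h0 : 0 < r => ?_)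
      exact ENNReal.ofReal_lt_iff_lt_toReal h0.le hx
    rw [this, Real.volume_Ioo, sub_zero, ENNReal.ofReal_toReal hx]

lemma lowerSemicontinuous_dirac (U : Opens X) :
    LowerSemicontinuous (fun x : X => dirac x U) := by
  classical
  have : (fun x : X => dirac x U) = (U : Set X).indicator (fun _ => 1) := by
    funext x
    rw [dirac_apply, Set.indicator_apply]
    rfl
  rw [this]
  exact U.isOpen.lowerSemicontinuous_indicator zero_le_one

lemma lowerSemicontinuous_const_mul {h : X → ℝ≥0∞} (hh : LowerSemicontinuous h) (c : ℝ≥0∞)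
    (hc : c ≠ ∞) : LowerSemicontinuous (fun x => c * h x) :=
  (ENNReal.continuous_const_mul hc).comp_lowerSemicontinuous hh fun _ _ h => mul_le_mul_right h c

lemma integral_add_indicator (μ : ContValuation X) (h : X → ℝ≥0∞) (hh : LowerSemicontinuous h)
    (c : ℝ) (hc : 0 < c) (U : Opens X)
    (hk : LowerSemicontinuous (fun x => h x + ENNReal.ofReal c * dirac x U)) :
    integral μ (fun x => h x + ENNReal.ofReal c * dirac x U) hk =
      integral μ h hh + ENNReal.ofReal c * μ U := by
  classical
  set G : ℝ → ℝ≥0∞ := fun r => if r < c then μ U else μ (U ⊓ level h hh (r - c)) with hG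
  set W : ℝ → ℝ≥0∞ := fun r => μ (U ⊓ level h hh r) with hW
  have hWa : Antitone W := fun r s hrs =>
    μ.monotone (inf_le_inf_left _ (level_antitone h hh hrs))
  have key : ∀ r ∈ Set.Ioi (0 : ℝ), μ (level _ hk r) + W r = μ (level h hh r) + G r := by
    intro r hr
    rw [hG, hW]
    dsimp only
    split_ifs with hrc
    · have e : level _ hk r = level h hh r ⊔ U := by
        ext x
        by_cases hx : x ∈ U
        · have h1 : ENNReal.ofReal r < h x + ENNReal.ofReal c :=
            lt_of_lt_of_le ((ENNReal.ofReal_lt_ofReal_iff hc).2 hrc) le_add_self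
          simpa [mem_level, dirac_apply, hx] using h1
        · simp [mem_level, dirac_apply, hx]
      rw [e, inf_comm]
      exact (μ.modular _ _).symm
    · have hrc := not_lt.1 hrc
      have e : level _ hk r = level h hh r ⊔ (U ⊓ level h hh (r - c)) := by
        ext x
        by_cases hx : x ∈ U
        · have h1 : ENNReal.ofReal r < h x + ENNReal.ofReal c ↔
              ENNReal.ofReal (r - c) < h x := by
            rw [ENNReal.ofReal_sub _ hc.le, ENNReal.sub_lt_iff_lt_right ENNReal.ofReal_ne_top
              (ENNReal.ofReal_le_ofReal hrc)]
          have h2 : ENNReal.ofReal r < h x → ENNReal.ofReal (r - c) < h x := fun h3 =>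
            lt_of_le_of_lt (ENNReal.ofReal_le_ofReal (by linarith)) h3
          have h4 : ENNReal.ofReal r < h x + ENNReal.ofReal c ↔
              (ENNReal.ofReal r < h x ∨ ENNReal.ofReal (r - c) < h x) := by tauto
          simpa [mem_level, dirac_apply, hx] using h4
        · simp [mem_level, dirac_apply, hx]
      have e2 : U ⊓ level h hh r = level h hh r ⊓ (U ⊓ level h hh (r - c)) := by
        have := level_antitone h hh (show r - c ≤ r by linarith)
        rw [inf_left_comm, inf_eq_left.2 this]
      rw [e, e2]
      exact (μ.modular _ _).symm
  have hGint : ∫⁻ r in Set.Ioi (0 : ℝ), G r =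
      ENNReal.ofReal c * μ U + ∫⁻ r in Set.Ioi (0 : ℝ), W r := by
    have hu : Set.Ioi (0 : ℝ) = Set.Ioo 0 c ∪ Set.Ici c := (Set.Ioo_union_Ici_eq_Ioi hc).symm
    have hdisj : Disjoint (Set.Ioo 0 c) (Set.Ici c) :=
      Set.disjoint_left.2 fun r h1 h2 => absurd h1.2 (not_lt.2 h2)
    rw [hu, lintegral_union measurableSet_Ici hdisj, ← hu]
    congr 1
    · rw [setLIntegral_congr_fun (g := fun _ => μ U) measurableSet_Ioo
        (fun r hr => by simp [hG, hr.2])]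
      simp [mul_comm]
    · rw [setLIntegral_congr_fun (g := fun r => W (r - c)) measurableSet_Ici
        (fun r hr => by simp [hG, hW, not_lt.2 (show c ≤ r from hr)])]
      rw [setLIntegral_congr (Ioi_ae_eq_Ici (μ := volume) (a := (0 : ℝ))),
        ← lintegral_indicator measurableSet_Ici, ← lintegral_indicator measurableSet_Ici,
        ← lintegral_sub_right_eq_self ((Set.Ici 0).indicator _) c]
      refine lintegral_congr fun r => ?_
      simp [Set.indicator_apply]
  have hsum : integral μ _ hk + ∫⁻ r in Set.Ioi (0 : ℝ), W r =
      integral μ h hh + (ENNReal.ofReal c * μ U + ∫⁻ r in Set.Ioi (0 : ℝ), W r) := by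
    rw [← hGint]
    unfold integral
    rw [← lintegral_add_right _ hWa.measurable,
      ← lintegral_add_left (apply_level_antitone μ h hh).measurable]
    exact setLIntegral_congr_fun measurableSet_Ioi key
  by_cases hfin : ∫⁻ r in Set.Ioi (0 : ℝ), W r = ∞
  · have h1 : integral μ h hh = ∞ := by
      refine top_le_iff.1 (hfin ▸ ?_)
      exact lintegral_mono fun r => μ.monotone inf_le_right
    have h2 : integral μ _ hk = ∞ :=
      top_le_iff.1 (h1 ▸ integral_mono μ fun x => le_self_add)
    rw [h1, h2, top_add]
  · rw [← add_assoc] at hsum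
    exact (ENNReal.add_left_inj hfin).1 hsum

lemma integral_add_step (μ : ContValuation X) (h : X → ℝ≥0∞) (hh : LowerSemicontinuous h)
    (N : ℕ) (A : ℕ → Opens X) (n : ℕ)
    (hk : LowerSemicontinuous
      (fun x => h x + (2⁻¹ : ℝ≥0∞) ^ N * ∑ k ∈ Finset.range n, dirac x (A k))) :
    integral μ (fun x => h x + (2⁻¹ : ℝ≥0∞) ^ N * ∑ k ∈ Finset.range n, dirac x (A k)) hk =
      integral μ h hh + (2⁻¹ : ℝ≥0∞) ^ N * ∑ k ∈ Finset.range n, μ (A k) := by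
  induction n with
  | zero => simp
  | succ n ih =>
    have h2 : (2⁻¹ : ℝ≥0∞) ^ N ≠ ∞ := by simp
    have hc : (2⁻¹ : ℝ≥0∞) ^ N = ENNReal.ofReal (2⁻¹ ^ N) := by
      rw [ENNReal.ofReal_pow (by norm_num), ENNReal.ofReal_inv_of_pos (by norm_num),
        ENNReal.ofReal_ofNat]
    have hn : LowerSemicontinuous
        (fun x => h x + (2⁻¹ : ℝ≥0∞) ^ N * ∑ k ∈ Finset.range n, dirac x (A k)) :=
      hh.add (lowerSemicontinuous_const_mul
        (lowerSemicontinuous_sum fun k _ => lowerSemicontinuous_dirac (A k)) _ h2)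
    have hn' := hn.add (lowerSemicontinuous_const_mul (lowerSemicontinuous_dirac (A n)) _ h2)
    rw [integral_congr hn' fun x => by rw [Finset.sum_range_succ, mul_add, add_assoc]]
    simp only [Finset.sum_range_succ, mul_add, ← add_assoc]
    rw [← ih hn]
    have hg : LowerSemicontinuous (fun x => (h x + (2⁻¹ : ℝ≥0∞) ^ N *
        ∑ k ∈ Finset.range n, dirac x (A k)) + ENNReal.ofReal (2⁻¹ ^ N) * dirac x (A n)) := by
      rw [← hc]; exact hn'
    have := integral_add_indicator μ _ hn (2⁻¹ ^ N) (by positivity) (A n) hg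
    simp only [← hc] at this
    exact this

lemma lowerSemicontinuous_lowerSum (k : X → ℝ≥0∞) (hk : LowerSemicontinuous k) (N : ℕ) :
    LowerSemicontinuous (fun x => lowerSum (fun r => dirac x (level k hk r)) N) :=
  lowerSemicontinuous_const_mul
    (lowerSemicontinuous_sum fun _ _ => lowerSemicontinuous_dirac _) _ (by simp)

lemma integral_add (μ : ContValuation X) (h k : X → ℝ≥0∞) (hh : LowerSemicontinuous h)
    (hk : LowerSemicontinuous k) (hhk : LowerSemicontinuous (fun x => h x + k x)) :
    integral μ (fun x => h x + k x) hhk = integral μ h hh + integral μ k hk := by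
  have e : ∀ x, h x + k x = ⨆ N, (h x + lowerSum (fun r => dirac x (level k hk r)) N) := by
    intro x
    rw [← ENNReal.add_iSup, ← integral_eq_iSup, integral_dirac]
  have hl : ∀ N, LowerSemicontinuous
      (fun x => h x + lowerSum (fun r => dirac x (level k hk r)) N) := fun N =>
    hh.add (lowerSemicontinuous_lowerSum k hk N)
  have hmono : Monotone (fun (N : ℕ) (x : X) =>
      h x + lowerSum (fun r => dirac x (level k hk r)) N) := fun M N hMN x =>
    add_le_add le_rfl (lowerSum_mono (apply_level_antitone (dirac x) k hk) hMN)
  rw [integral_congr (lowerSemicontinuous_iSup hl) e,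
    integral_iSup μ _ hl hmono.directed_le, integral_eq_iSup μ k hk, ENNReal.add_iSup]
  exact iSup_congr fun N => integral_add_step μ h hh N _ _ (hl N)

lemma integral_zero (μ : ContValuation X) (hz : LowerSemicontinuous (fun _ : X => (0 : ℝ≥0∞))) :
    integral μ (fun _ => 0) hz = 0 := by
  unfold integral
  have : ∀ r, level (fun _ : X => (0 : ℝ≥0∞)) hz r = ⊥ := by
    intro r; ext x; simp [level]
  simp_rw [this]
  have h0 : μ ⊥ = 0 := μ.strict
  simp [h0]

lemma integral_sum (μ : ContValuation X) (h : ℕ → X → ℝ≥0∞) (hh : ∀ k, LowerSemicontinuous (h k))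
    (n : ℕ) (hs : LowerSemicontinuous (fun x => ∑ k ∈ Finset.range n, h k x)) :
    integral μ (fun x => ∑ k ∈ Finset.range n, h k x) hs =
      ∑ k ∈ Finset.range n, integral μ (h k) (hh k) := by
  induction n with
  | zero => simpa using integral_zero μ _
  | succ n ih =>
    have hn : LowerSemicontinuous (fun x => ∑ k ∈ Finset.range n, h k x) :=
      lowerSemicontinuous_sum fun k _ => hh k
    rw [Finset.sum_range_succ, ← ih hn, ← integral_add μ _ _ hn (hh n) (hn.add (hh n))]
    exact integral_congr _ fun x => Finset.sum_range_succ _ _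

lemma integral_pow_mul (μ : ContValuation X) (N : ℕ) (h : X → ℝ≥0∞) (hh : LowerSemicontinuous h)
    (hN : LowerSemicontinuous (fun x => (2⁻¹ : ℝ≥0∞) ^ N * h x)) :
    integral μ (fun x => (2⁻¹ : ℝ≥0∞) ^ N * h x) hN = (2⁻¹ : ℝ≥0∞) ^ N * integral μ h hh := by
  induction N with
  | zero => simp
  | succ N ih =>
    have h1 := lowerSemicontinuous_const_mul hh ((2⁻¹ : ℝ≥0∞) ^ N) (by simp)
    have h22 : (2⁻¹ : ℝ≥0∞) * 2 = 1 := ENNReal.inv_mul_cancel (by simp) (by simp)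
    have e : integral μ _ h1 = integral μ _ hN + integral μ _ hN := by
      rw [← integral_add μ _ _ hN hN (hN.add hN)]
      refine integral_congr _ fun x => ?_
      rw [← two_mul, pow_succ', mul_assoc, ← mul_assoc 2, mul_comm 2, h22, one_mul]
    refine Eq.trans ?_ (congrArg (· * _) (pow_succ' _ _).symm)
    rw [mul_assoc, ← ih h1, e, ← two_mul, ← mul_assoc, h22, one_mul]

lemma lowerSemicontinuous_integral (h : X → ℝ≥0∞) (hh : LowerSemicontinuous h) :
    LowerSemicontinuous (fun μ : ContValuation X => integral μ h hh) := by
  simp_rw [integral_eq_iSup]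
  exact lowerSemicontinuous_iSup fun N => lowerSemicontinuous_const_mul
    (lowerSemicontinuous_sum fun _ _ => lowerSemicontinuous_eval _) _ (by simp)

lemma integral_map (f : C(X, Y)) (μ : ContValuation X) (h : Y → ℝ≥0∞)
    (hh : LowerSemicontinuous h) :
    integral (map f μ) h hh = integral μ (fun x => h (f x)) (hh.comp f.continuous) := rfl

/-- The integral of the characteristic function of `U`. -/
lemma integral_apply_dirac (μ : ContValuation X) (U : Opens X) :
    integral μ (fun x => dirac x U) (lowerSemicontinuous_dirac U) = μ U := by
  have hz : LowerSemicontinuous (fun _ : X => (0 : ℝ≥0∞)) := lowerSemicontinuous_const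
  have hl := hz.add (lowerSemicontinuous_const_mul (lowerSemicontinuous_dirac U)
    (ENNReal.ofReal 1) (by simp))
  have h := integral_add_indicator μ (fun _ => 0) hz 1 one_pos U hl
  rw [integral_zero, zero_add] at h
  calc _ = _ := integral_congr hl fun x => by simp
    _ = _ := h
    _ = μ U := by simp

/-! ### The monad -/

lemma lowerSemicontinuous_apply (f : C(X, ContValuation Y)) (U : Opens Y) :
    LowerSemicontinuous (fun x => f x U) :=
  (lowerSemicontinuous_eval U).comp f.continuous

/-- The extension `f†` of `f : X → V Y`, given by `f† μ U = ∫ f x U dμ(x)`. -/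
def bind (f : C(X, ContValuation Y)) (μ : ContValuation X) : ContValuation Y where
  toFun U := integral μ (fun x => f x U) (lowerSemicontinuous_apply f U)
  strict := by
    rw [integral_congr lowerSemicontinuous_const fun x => (f x).apply_bot]
    exact integral_zero μ _
  mono U V h := integral_mono μ fun x => (f x).monotone h
  modular U V := by
    have l := lowerSemicontinuous_apply f
    rw [← integral_add μ _ _ (l U) (l V) ((l U).add (l V)),
      ← integral_add μ _ _ (l (U ⊔ V)) (l (U ⊓ V)) ((l (U ⊔ V)).add (l (U ⊓ V)))]
    exact integral_congr _ fun x => (f x).modular U V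
  scott := by
    refine scottContinuous_of_iSup (fun U V h => integral_mono μ fun x => (f x).monotone h) ?_
    intro d hd hd'
    have l := fun i : d => lowerSemicontinuous_apply f (i : Opens Y)
    rw [integral_congr (lowerSemicontinuous_iSup l) fun x => (f x).map_iSup _ hd']
    refine le_of_eq (integral_iSup μ _ l (fun i j => ?_) _)
    exact (hd' i j).imp fun k hk => ⟨fun x => (f x).monotone hk.1, fun x => (f x).monotone hk.2⟩

lemma bind_apply (f : C(X, ContValuation Y)) (μ : ContValuation X) (U : Opens Y) :
    bind f μ U = integral μ (fun x => f x U) (lowerSemicontinuous_apply f U) := rfl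

lemma continuous_bind (f : C(X, ContValuation Y)) : Continuous (bind f) :=
  continuous_of_lowerSemicontinuous fun _ => lowerSemicontinuous_integral _ _

lemma continuous_map (f : C(X, Y)) : Continuous (map f) :=
  continuous_of_lowerSemicontinuous fun U => lowerSemicontinuous_eval (U.comap f)

lemma continuous_dirac : Continuous (dirac : X → ContValuation X) :=
  continuous_of_lowerSemicontinuous lowerSemicontinuous_dirac

/-- The disintegration formula. -/
lemma integral_bind (f : C(X, ContValuation Y)) (μ : ContValuation X) (h : Y → ℝ≥0∞)
    (hh : LowerSemicontinuous h) :
    integral (bind f μ) h hh = integral μ (fun x => integral (f x) h hh)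
      ((lowerSemicontinuous_integral h hh).comp f.continuous) := by
  have l := lowerSemicontinuous_apply f
  have ls : ∀ N : ℕ, LowerSemicontinuous (fun x => ∑ k ∈ Finset.range (N * 2 ^ N),
      f x (level h hh (((k : ℝ) + 1) / 2 ^ N))) := fun N => lowerSemicontinuous_sum fun k _ => l _
  have lN : ∀ N, LowerSemicontinuous (fun x => lowerSum (fun r => f x (level h hh r)) N) :=
    fun N => lowerSemicontinuous_const_mul (ls N) _ (by simp)
  have hmono : Monotone (fun (N : ℕ) (x : X) => lowerSum (fun r => f x (level h hh r)) N) :=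
    fun M N hMN x => lowerSum_mono (apply_level_antitone (f x) h hh) hMN
  rw [integral_congr (lowerSemicontinuous_iSup lN) fun x => integral_eq_iSup (f x) h hh,
    integral_iSup μ _ lN hmono.directed_le, integral_eq_iSup]
  refine iSup_congr fun N => ?_
  refine Eq.trans ?_ (integral_pow_mul μ N _ (ls N) (lN N)).symm
  rw [integral_sum μ _ (fun k => l _)]
  rfl

/-- The multiplication `m ϖ U = ∫ ν U dϖ(ν)`. -/
def join (ϖ : ContValuation (ContValuation X)) : ContValuation X :=
  bind (ContinuousMap.id (ContValuation X)) ϖ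

lemma join_apply (ϖ : ContValuation (ContValuation X)) (U : Opens X) :
    join ϖ U = integral ϖ (fun ν => ν U) (lowerSemicontinuous_eval U) := rfl

lemma join_map_join (Ξ : ContValuation (ContValuation (ContValuation X))) :
    join (map ⟨join, continuous_bind _⟩ Ξ) = join (join Ξ) :=
  ContValuation.ext_opens fun U => (integral_bind
    (ContinuousMap.id (ContValuation (ContValuation X))) Ξ _ (lowerSemicontinuous_eval U)).symm

lemma join_dirac (μ : ContValuation X) : join (dirac μ) = μ :=
  ContValuation.ext_opens fun U => integral_dirac μ _ (lowerSemicontinuous_eval U)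

lemma join_map_dirac (μ : ContValuation X) :
    join (map ⟨dirac, continuous_dirac⟩ μ) = μ :=
  ContValuation.ext_opens fun U => integral_apply_dirac μ U

/-- The category of `T₀` spaces and continuous maps. -/
abbrev TopT0 : Type (u + 1) :=
  ObjectProperty.FullSubcategory (fun X : TopCat.{u} => T0Space X)

/-- The valuation powerdomain functor on `T₀` spaces. -/
def valuationFunctor : TopT0.{u} ⥤ TopT0.{u} where
  obj X := ⟨TopCat.of (ContValuation X.obj), inferInstanceAs (T0Space (ContValuation X.obj))⟩
  map f := ObjectProperty.homMk (TopCat.ofHom ⟨map f.hom.hom, continuous_map f.hom.hom⟩)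

/-- The extended probabilistic powerdomain monad on `T₀` spaces. -/
def valuationMonad : CategoryTheory.Monad TopT0.{u} where
  toFunctor := valuationFunctor
  η := { app := fun X => ObjectProperty.homMk (TopCat.ofHom ⟨dirac, continuous_dirac⟩) }
  μ := { app := fun X => ObjectProperty.homMk (TopCat.ofHom ⟨join, continuous_bind _⟩) }
  assoc X := by
    ext Ξ
    exact join_map_join (X := X.obj) Ξ
  left_unit X := by
    ext μ
    exact join_dirac (X := X.obj) μ
  right_unit X := by
    ext μ
    exact join_map_dirac (X := X.obj) μ

/-- The underlying space of an Eilenberg-Moore algebra of the valuation monad. -/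
abbrev carrier (A : valuationMonad.{u}.Algebra) : Type u := A.A.obj

/-- The structure map of an Eilenberg-Moore algebra of the valuation monad. -/
def structureMap (A : valuationMonad.{u}.Algebra) : ContValuation (carrier A) → carrier A :=
  fun μ => A.a.hom.hom μ

/-! ### Topological cones

A cone is a module over the semiring `ℝ≥0` of nonnegative reals. -/

/-- A topological cone: the topology is `T₀`, and addition and scalar multiplication are jointly
continuous, where the scalars carry the Scott topology. -/
structure IsTopologicalCone (C : Type u) [TopologicalSpace C] [AddCommMonoid C]
    [Module ℝ≥0 C] : Prop where
  t0 : T0Space C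
  continuous_add : Continuous fun p : C × C => p.1 + p.2
  continuous_smul :
    Continuous fun p : Topology.WithScott ℝ≥0 × C => Topology.WithScott.ofScott p.1 • p.2

/-- Every open neighbourhood of a point contains a (not necessarily open) convex neighbourhood. -/
def IsWeaklyLocallyConvex (C : Type u) [TopologicalSpace C] [AddCommMonoid C]
    [Module ℝ≥0 C] : Prop :=
  ∀ (x : C) (U : Set C), IsOpen U → x ∈ U → ∃ N ∈ 𝓝 x, Convex ℝ≥0 N ∧ N ⊆ U

/-- A half-space is a convex set with convex complement. -/
def IsHalfSpace {C : Type u} [AddCommMonoid C] [Module ℝ≥0 C] (H : Set C) : Prop :=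
  Convex ℝ≥0 H ∧ Convex ℝ≥0 Hᶜ

/-- The topology has a subbase of open half-spaces. -/
def IsLocallyLinear (C : Type u) [t : TopologicalSpace C] [AddCommMonoid C]
    [Module ℝ≥0 C] : Prop :=
  ∃ B : Set (Set C), (∀ H ∈ B, IsHalfSpace H) ∧ t = TopologicalSpace.generateFrom B

/-- A space is sober if every irreducible closed set is the closure of a unique point. -/
def IsSober (C : Type u) [TopologicalSpace C] : Prop :=
  ∀ S : Set C, IsIrreducible S → IsClosed S → ∃! x, closure {x} = S

/-- A linear retraction: a continuous linear map with a continuous section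
(the section need not be linear). -/
def IsLinearRetraction {C D : Type u} [TopologicalSpace C] [AddCommMonoid C] [Module ℝ≥0 C]
    [TopologicalSpace D] [AddCommMonoid D] [Module ℝ≥0 D] (r : C → D) : Prop :=
  Continuous r ∧ IsLinearMap ℝ≥0 r ∧ ∃ s : D → C, Continuous s ∧ ∀ y, r (s y) = y

end

end ProbPowerdomain

namespace ProbPowerdomain

noncomputable section

variable {X Y : Type u} [TopologicalSpace X] [TopologicalSpace Y]

/-! ### The cone of continuous valuations -/

/-! By the unit law, an algebra structure `α` is a continuous retraction of the valuation space onto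
`X` with section `x ↦ δ_x`; the required properties of `X` are transported along it.

Algebra: the monad multiplication is linear (`join_add`, `join_smul`). Evaluating the associativity
law at `δ_μ + δ_ν` and at `r δ_μ` therefore gives `α(δ_{αμ} + δ_{αν}) = α(μ + ν)` and `α(r δ_{αμ}) =
α(rμ)` (`IsAlgebra.apply_add`, `IsAlgebra.apply_smul`). These identities say that `α` is linear, and
with the unit law they reduce each cone axiom on `X` to the same axiom for valuations.

Topology: evaluation at an open set is linear, so the subbasic sets `[U > r]` are half-spaces. An
irreducible set of valuations behaves like a directed one: its pointwise supremum is again a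
continuous valuation (`irreducibleSup`), and this is the generic point of the set if it is closed.
Sobriety descends along every continuous retraction onto a `T₀` space. Weak local convexity descends
along linear retractions by taking images of convex neighbourhoods; such images need not be open. -/

lemma integral_add_valuation (μ ν : ContValuation X) (h : X → ℝ≥0∞)
    (hh : LowerSemicontinuous h) :
    integral (μ + ν) h hh = integral μ h hh + integral ν h hh := by
  unfold integral
  exact lintegral_add_left (apply_level_antitone μ h hh).measurable _

lemma integral_smul_valuation (r : ℝ≥0) (μ : ContValuation X) (h : X → ℝ≥0∞)
    (hh : LowerSemicontinuous h) :
    integral (r • μ) h hh = r * integral μ h hh := by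
  unfold integral
  exact lintegral_const_mul _ (apply_level_antitone μ h hh).measurable

lemma join_add (ϖ ξ : ContValuation (ContValuation X)) : join (ϖ + ξ) = join ϖ + join ξ :=
  ContValuation.ext_opens fun U => integral_add_valuation ϖ ξ _ (lowerSemicontinuous_eval U)

lemma join_smul (r : ℝ≥0) (ϖ : ContValuation (ContValuation X)) : join (r • ϖ) = r • join ϖ :=
  ContValuation.ext_opens fun U => integral_smul_valuation r ϖ _ (lowerSemicontinuous_eval U)

lemma map_add (f : C(X, Y)) (μ ν : ContValuation X) : map f (μ + ν) = map f μ + map f ν := rfl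

lemma map_smul (f : C(X, Y)) (r : ℝ≥0) (μ : ContValuation X) : map f (r • μ) = r • map f μ := rfl

lemma map_dirac (f : C(X, Y)) (x : X) : map f (dirac x) = dirac (f x) := rfl

/-- This is where the Scott topology on the scalars enters: each set `(a, ∞]` is upper and
inaccessible by directed suprema. -/
lemma lowerSemicontinuous_ofScott : LowerSemicontinuous
    fun r : Topology.WithScott ℝ≥0 => ((Topology.WithScott.ofScott r : ℝ≥0) : ℝ≥0∞) := by
  rw [lowerSemicontinuous_iff_isOpen_preimage]
  intro a
  refine (Topology.IsScott.isOpen_iff_isUpperSet_and_dirSupInaccOn (D := Set.univ)).2 ⟨?_, ?_⟩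
  · intro r s hrs hr
    exact lt_of_lt_of_le hr (ENNReal.coe_le_coe.2 hrs)
  · intro d _ hd _ b hb hab
    by_contra hne
    have hle : ∀ r ∈ d, ((Topology.WithScott.ofScott r : ℝ≥0) : ℝ≥0∞) ≤ a := fun r hr =>
      not_lt.1 fun hlt => hne ⟨r, hr, hlt⟩
    -- Since `a` is below the finite `b`, it is an upper bound of `d` within the scalars and can be
    -- compared with the least upper bound `b`.
    have ha : a ≠ ∞ := fun h => by simp [h] at hab
    lift a to ℝ≥0 using ha
    refine absurd (ENNReal.coe_le_coe.2 (hb.2 (show Topology.WithScott.toScott a ∈ _ from ?_)))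
      (not_le.2 hab)
    exact fun r hr => ENNReal.coe_le_coe.1 (hle r hr)

/-- Multiplication on `[0, ∞]` is discontinuous at `(0, ∞)`, but every product is the supremum of
the products of strictly smaller factors, also under the convention `0 · ∞ = 0`. That suffices for
semicontinuity. -/
lemma lowerSemicontinuous_mul {f g : X → ℝ≥0∞} (hf : LowerSemicontinuous f)
    (hg : LowerSemicontinuous g) : LowerSemicontinuous fun x => f x * g x := by
  intro x y hy
  obtain ⟨a, ha, b, hb, hab⟩ : ∃ a < f x, ∃ b < g x, y < a * b := by
    by_contra! h
    exact not_le.2 hy (ENNReal.mul_le_of_forall_lt h)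
  filter_upwards [hf x a ha, hg x b hb] with z hz hz'
  exact hab.trans_le (mul_le_mul' hz.le hz'.le)

lemma ContValuation.isTopologicalCone : IsTopologicalCone (ContValuation X) where
  t0 := inferInstance
  continuous_add := continuous_of_lowerSemicontinuous fun U =>
    ((lowerSemicontinuous_eval U).comp continuous_fst).add
      ((lowerSemicontinuous_eval U).comp continuous_snd)
  continuous_smul := continuous_of_lowerSemicontinuous fun U =>
    lowerSemicontinuous_mul (lowerSemicontinuous_ofScott.comp continuous_fst)
      ((lowerSemicontinuous_eval U).comp continuous_snd)

/-- Evaluation at `U` is linear into `[0, ∞]`, and rays there are convex. Comparing with `min (μ U)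
(ν U)` replaces the open ray by a closed one, so no strict inequality has to survive a vanishing
weight or an infinite value. -/
lemma isHalfSpace_lt_apply (U : Opens X) (r : ℝ≥0) :
    IsHalfSpace {μ : ContValuation X | (r : ℝ≥0∞) < μ U} := by
  constructor
  · intro μ hμ ν hν a b ha hb hab
    have h : min (μ U) (ν U) ≤ (a • μ + b • ν) U :=
      convex_Ici (𝕜 := ℝ≥0) (min (μ U) (ν U))
        (Set.mem_Ici.2 (min_le_left (μ U) (ν U))) (Set.mem_Ici.2 (min_le_right (μ U) (ν U))) ha hb hab
    exact (lt_min hμ hν).trans_le h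
  · intro μ hμ ν hν a b ha hb hab
    have h : (a • μ + b • ν) U ≤ r :=
      convex_Iic (𝕜 := ℝ≥0) (r : ℝ≥0∞)
        (Set.mem_Iic.2 (not_lt.1 (show ¬ (r : ℝ≥0∞) < μ U from hμ)))
        (Set.mem_Iic.2 (not_lt.1 (show ¬ (r : ℝ≥0∞) < ν U from hν))) ha hb hab
    exact not_lt.2 h

lemma ContValuation.isLocallyLinear : IsLocallyLinear (ContValuation X) := by
  refine ⟨_, ?_, rfl⟩
  rintro _ ⟨U, r, rfl⟩
  exact isHalfSpace_lt_apply U r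

lemma IsLocallyLinear.isWeaklyLocallyConvex {C : Type u} [TopologicalSpace C] [AddCommMonoid C]
    [Module ℝ≥0 C] (h : IsLocallyLinear C) : IsWeaklyLocallyConvex C := by
  obtain ⟨B, hB, ht⟩ := h
  intro x U hU hx
  obtain ⟨_, ⟨F, ⟨hF, hFB⟩, rfl⟩, hxF, hFU⟩ :=
    (isTopologicalBasis_of_subbasis ht).exists_subset_of_mem_open hx hU
  refine ⟨⋂₀ F, (isTopologicalBasis_of_subbasis ht).mem_nhds ⟨F, ⟨hF, hFB⟩, rfl⟩ hxF, ?_, hFU⟩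
  exact convex_sInter fun H hH => (hB H (hFB hH)).1

/-! ### Sobriety -/

/-- Two open sets that each meet an irreducible set meet it in a common point. This is the
substitute for directedness of `S`. -/
lemma exists_mem_lt_apply {S : Set (ContValuation X)} (hS : IsIrreducible S)
    {U V : Opens X} {r s : ℝ≥0∞} (hr : r < ⨆ ν : S, ν.1 U) (hs : s < ⨆ ν : S, ν.1 V) :
    ∃ ν ∈ S, r < ν U ∧ s < ν V := by
  obtain ⟨ν, hν⟩ := lt_iSup_iff.1 hr
  obtain ⟨ρ, hρ⟩ := lt_iSup_iff.1 hs
  obtain ⟨σ, hσ, h1, h2⟩ := hS.2 _ _ ((lowerSemicontinuous_eval U).isOpen_preimage r)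
    ((lowerSemicontinuous_eval V).isOpen_preimage s) ⟨ν, ν.2, hν⟩ ⟨ρ, ρ.2, hρ⟩
  exact ⟨σ, hσ, h1, h2⟩

lemma iSup_apply_add_iSup_apply {S : Set (ContValuation X)} (hS : IsIrreducible S)
    (U V : Opens X) :
    (⨆ ν : S, ν.1 U) + (⨆ ν : S, ν.1 V) = ⨆ ν : S, (ν.1 U + ν.1 V) := by
  have : Nonempty S := hS.1.to_subtype
  apply le_antisymm
  · refine le_of_forall_lt fun a ha => ?_
    -- Splitting `a` below a sum needs a number strictly below each summand, hence the separate
    -- treatment of a vanishing supremum.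
    by_cases hU : (⨆ ν : S, ν.1 U) = 0
    · rw [hU, zero_add] at ha
      obtain ⟨ν, hν⟩ := lt_iSup_iff.1 ha
      exact lt_iSup_iff.2 ⟨ν, hν.trans_le le_add_self⟩
    by_cases hV : (⨆ ν : S, ν.1 V) = 0
    · rw [hV, add_zero] at ha
      obtain ⟨ν, hν⟩ := lt_iSup_iff.1 ha
      exact lt_iSup_iff.2 ⟨ν, hν.trans_le le_self_add⟩
    obtain ⟨r, hr, s, hs, hrs⟩ := ENNReal.exists_lt_add_of_lt_add ha hU hV
    obtain ⟨ν, hν, h1, h2⟩ := exists_mem_lt_apply hS hr hs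
    exact lt_iSup_iff.2 ⟨⟨ν, hν⟩, hrs.trans_le (add_le_add h1.le h2.le)⟩
  · exact iSup_le fun ν => add_le_add (le_iSup (fun ν : S => ν.1 U) ν)
      (le_iSup (fun ν : S => ν.1 V) ν)

/-- The pointwise supremum of an irreducible set of valuations. -/
def irreducibleSup (S : Set (ContValuation X)) (hS : IsIrreducible S) : ContValuation X where
  toFun U := ⨆ ν : S, ν.1 U
  strict := by simp [ContValuation.apply_bot]
  mono U V h := iSup_mono fun ν => ν.1.monotone h
  modular U V := by
    rw [iSup_apply_add_iSup_apply hS, iSup_apply_add_iSup_apply hS]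
    exact iSup_congr fun ν => ν.1.modular U V
  scott := by
    refine scottContinuous_of_iSup (fun U V h => iSup_mono fun ν => ν.1.monotone h) ?_
    intro d hd hd'
    rw [iSup_comm]
    exact iSup_mono fun ν => (ν.1.map_iSup _ hd').le

lemma ContValuation.isSober : IsSober (ContValuation X) := by
  intro S hS hc
  have hcl : closure {irreducibleSup S hS} = S := by
    apply Set.Subset.antisymm
    -- The supremum lies in `S`: each subbasic set containing it already contains a member of `S`,
    -- and by irreducibility a finite intersection of such sets still meets `S`.
    · refine hc.closure_subset_iff.2 (Set.singleton_subset_iff.2 ?_)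
      refine hc.closure_subset
        ((isTopologicalBasis_of_subbasis (rfl : _ = generateFrom _)).mem_closure_iff.2 ?_)
      rintro _ ⟨F, ⟨hF, hFB⟩, rfl⟩ hmem
      rw [Set.inter_comm]
      have := (isIrreducible_iff_sInter.1 hS) hF.toFinset
      simp only [Set.Finite.mem_toFinset, Set.Finite.coe_toFinset] at this
      refine this (fun H hH => .basic _ (hFB hH)) fun H hH => ?_
      obtain ⟨U, r, rfl⟩ := hFB hH
      obtain ⟨ν, hν⟩ := lt_iSup_iff.1 (show _ < ⨆ ν : S, ν.1 U from hmem _ hH)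
      exact ⟨ν, ν.2, hν⟩
    -- Every `ν ∈ S` is pointwise below the supremum, so each basic neighbourhood of `ν` contains
    -- the supremum.
    · intro ν hν
      refine (isTopologicalBasis_of_subbasis (rfl : _ = generateFrom _)).mem_closure_iff.2 ?_
      rintro _ ⟨F, ⟨hF, hFB⟩, rfl⟩ hmem
      refine ⟨_, fun H hH => ?_, rfl⟩
      obtain ⟨U, r, rfl⟩ := hFB hH
      have h1 : (r : ℝ≥0∞) < ν U := hmem _ hH
      exact h1.trans_le (le_iSup (fun ν : S => ν.1 U) ⟨ν, hν⟩)
  refine ⟨_, hcl, fun μ hμ => ?_⟩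
  exact (inseparable_iff_closure_eq.2 (hμ.trans hcl.symm)).eq

/-- If `x` is the generic point of the closure of `s '' S`, then `r x` is generic in `S`, because
continuous maps send closures into closures and `r` undoes `s`. -/
lemma IsSober.of_retract [T0Space Y] (hX : IsSober X) {r : X → Y} {s : Y → X}
    (hr : Continuous r) (hs : Continuous s) (hrs : ∀ y, r (s y) = y) : IsSober Y := by
  intro S hS hc
  obtain ⟨x, hx, -⟩ := hX _ (hS.image s hs.continuousOn).closure isClosed_closure
  have hcl : closure {r x} = S := by
    apply Set.Subset.antisymm
    · refine hc.closure_subset_iff.2 (Set.singleton_subset_iff.2 ?_)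
      have h1 : x ∈ closure (s '' S) := hx ▸ subset_closure rfl
      have h2 := map_mem_closure hr h1 (t := S) fun z hz => by
        obtain ⟨y, hy, rfl⟩ := hz
        rwa [hrs]
      rwa [hc.closure_eq] at h2
    · intro y hy
      have h1 : s y ∈ closure {x} := hx ▸ subset_closure ⟨y, hy, rfl⟩
      rw [← hrs y]
      exact map_mem_closure hr h1 fun z hz => congrArg r hz
  exact ⟨_, hcl, fun y hy => (inseparable_iff_closure_eq.2 (hy.trans hcl.symm)).eq⟩

/-! ### Algebras -/

/-- A continuous map satisfying the two Eilenberg-Moore laws of the valuation monad. -/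
structure IsAlgebra (α : C(ContValuation X, X)) : Prop where
  unit : ∀ x, α (dirac x) = x
  assoc : ∀ ϖ, α (map α ϖ) = α (join ϖ)

namespace IsAlgebra

variable {α : C(ContValuation X, X)}

/-- Associativity at `δ_μ + δ_ν`, whose image under `join` is `μ + ν`. -/
lemma apply_add (h : IsAlgebra α) (μ ν : ContValuation X) :
    α (dirac (α μ) + dirac (α ν)) = α (μ + ν) := by
  have := h.assoc (dirac μ + dirac ν)
  rwa [join_add, join_dirac, join_dirac, map_add, map_dirac, map_dirac] at this

lemma apply_smul (h : IsAlgebra α) (r : ℝ≥0) (μ : ContValuation X) :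
    α (r • dirac (α μ)) = α (r • μ) := by
  have := h.assoc (r • dirac μ)
  rwa [join_smul, join_dirac, map_smul, map_dirac] at this

/-- Addition on the carrier of an algebra. -/
abbrev addCommMonoid (h : IsAlgebra α) : AddCommMonoid X where
  add x y := α (dirac x + dirac y)
  zero := α 0
  nsmul := @nsmulRec X ⟨α 0⟩ ⟨fun x y => α (dirac x + dirac y)⟩
  add_assoc x y z := by
    change α (dirac (α (dirac x + dirac y)) + dirac z) = α (dirac x + dirac (α (dirac y + dirac z)))
    -- Writing the bare points as `α(δ_z)` and `α(δ_x)` puts both sides in the form to which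
    -- `apply_add` applies.
    nth_rw 1 [← h.unit z]
    nth_rw 2 [← h.unit x]
    rw [h.apply_add, h.apply_add, add_assoc]
  zero_add x := by
    change α (dirac (α 0) + dirac x) = x
    nth_rw 1 [← h.unit x]
    rw [h.apply_add, zero_add, h.unit]
  add_zero x := by
    change α (dirac x + dirac (α 0)) = x
    nth_rw 1 [← h.unit x]
    rw [h.apply_add, add_zero, h.unit]
  add_comm x y := congrArg α (add_comm _ _)

/-- The cone structure on the carrier of an algebra. -/
abbrev module (h : IsAlgebra α) : letI := h.addCommMonoid; Module ℝ≥0 X :=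
  letI := h.addCommMonoid
  { smul := fun r x => α (r • dirac x)
    one_smul := fun x => by
      change α ((1 : ℝ≥0) • dirac x) = x
      rw [one_smul, h.unit]
    mul_smul := fun r s x => by
      change α ((r * s) • dirac x) = α (r • dirac (α (s • dirac x)))
      rw [h.apply_smul, mul_smul]
    smul_zero := fun r => by
      change α (r • dirac (α 0)) = α 0
      rw [h.apply_smul, smul_zero]
    smul_add := fun r x y => by
      change α (r • dirac (α (dirac x + dirac y))) =
        α (dirac (α (r • dirac x)) + dirac (α (r • dirac y)))
      rw [h.apply_smul, h.apply_add, smul_add]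
    add_smul := fun r s x => by
      change α ((r + s) • dirac x) = α (dirac (α (r • dirac x)) + dirac (α (s • dirac x)))
      rw [h.apply_add, add_smul]
    zero_smul := fun x => by
      change α ((0 : ℝ≥0) • dirac x) = α 0
      rw [zero_smul] }

lemma isLinearMap (h : IsAlgebra α) :
    letI := h.addCommMonoid
    letI := h.module
    IsLinearMap ℝ≥0 α :=
  letI := h.addCommMonoid
  letI := h.module
  { map_add := fun μ ν => (h.apply_add μ ν).symm
    map_smul := fun r μ => (h.apply_smul r μ).symm }

/-- Each operation on `X` is the operation on valuations, preceded by `δ` in the point arguments and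
followed by `α`. -/
lemma isTopologicalCone [T0Space X] (h : IsAlgebra α) :
    letI := h.addCommMonoid
    letI := h.module
    IsTopologicalCone X :=
  letI := h.addCommMonoid
  letI := h.module
  { t0 := inferInstance
    continuous_add := α.continuous.comp (ContValuation.isTopologicalCone.continuous_add.comp
      (continuous_dirac.prodMap continuous_dirac))
    continuous_smul := α.continuous.comp (ContValuation.isTopologicalCone.continuous_smul.comp
      (continuous_id.prodMap continuous_dirac)) }

end IsAlgebra

/-- Weak local convexity passes to linear retracts. -/
lemma IsLinearRetraction.isWeaklyLocallyConvex {C D : Type u} [TopologicalSpace C]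
    [AddCommMonoid C] [Module ℝ≥0 C] [TopologicalSpace D] [AddCommMonoid D] [Module ℝ≥0 D]
    {r : C → D} (hr : IsLinearRetraction r) (hC : IsWeaklyLocallyConvex C) :
    IsWeaklyLocallyConvex D := by
  obtain ⟨hc, hl, s, hs, hrs⟩ := hr
  intro y U hU hy
  obtain ⟨N, hN, hconv, hNU⟩ := hC (s y) (r ⁻¹' U) (hU.preimage hc) (by simpa [hrs] using hy)
  -- The image contains `s ⁻¹' N`, which is a neighbourhood of `y` by continuity of `s`; convexity
  -- of the image comes from linearity of `r` alone.
  refine ⟨r '' N, ?_, hconv.is_linear_image hl, Set.image_subset_iff.2 hNU⟩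
  exact Filter.mem_of_superset (hs.continuousAt hN) fun z hz => ⟨s z, hz, hrs z⟩

/-- The section is the unit. It is never linear: `δ_0` has total mass `1`, so it is not the zero
valuation. -/
lemma IsAlgebra.isLinearRetraction {α : C(ContValuation X, X)} (h : IsAlgebra α) :
    letI := h.addCommMonoid
    letI := h.module
    IsLinearRetraction α :=
  letI := h.addCommMonoid
  letI := h.module
  ⟨α.continuous, h.isLinearMap, dirac, continuous_dirac, h.unit⟩

/-- The categorical algebra laws, read off at points. -/
lemma isAlgebra_structureMap (A : valuationMonad.{u}.Algebra) :
    IsAlgebra (X := carrier A) A.a.hom.hom where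
  unit x := congrArg (fun f => f.hom.hom x) A.unit
  assoc ϖ := (congrArg (fun f => f.hom.hom ϖ) A.assoc).symm

end

end ProbPowerdomain

theorem mainTheorem1 (A : ProbPowerdomain.valuationMonad.{u}.Algebra) :
    ∃ (_ : AddCommMonoid (ProbPowerdomain.carrier A))
      (_ : Module ℝ≥0 (ProbPowerdomain.carrier A)),
      (∀ x y : ProbPowerdomain.carrier A,
        x + y = ProbPowerdomain.structureMap A
          (ProbPowerdomain.dirac x + ProbPowerdomain.dirac y)) ∧
      (∀ (r : ℝ≥0) (x : ProbPowerdomain.carrier A),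
        r • x = ProbPowerdomain.structureMap A (r • ProbPowerdomain.dirac x)) ∧
      ProbPowerdomain.IsTopologicalCone (ProbPowerdomain.carrier A) ∧
      ProbPowerdomain.IsWeaklyLocallyConvex (ProbPowerdomain.carrier A) ∧
      ProbPowerdomain.IsSober (ProbPowerdomain.carrier A) ∧
      IsLinearMap ℝ≥0 (ProbPowerdomain.structureMap A) ∧
      ProbPowerdomain.IsLinearRetraction (ProbPowerdomain.structureMap A) ∧
      ProbPowerdomain.IsTopologicalCone
        (ProbPowerdomain.ContValuation (ProbPowerdomain.carrier A)) ∧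
      ProbPowerdomain.IsLocallyLinear
        (ProbPowerdomain.ContValuation (ProbPowerdomain.carrier A)) ∧
      ProbPowerdomain.IsSober
        (ProbPowerdomain.ContValuation (ProbPowerdomain.carrier A)) := by
  have h := ProbPowerdomain.isAlgebra_structureMap A
  have : T0Space (ProbPowerdomain.carrier A) := A.A.property
  let _ := h.addCommMonoid
  let _ := h.module
  exact ⟨h.addCommMonoid, h.module, fun _ _ => rfl, fun _ _ => rfl, h.isTopologicalCone,
    h.isLinearRetraction.isWeaklyLocallyConvex
      ProbPowerdomain.ContValuation.isLocallyLinear.isWeaklyLocallyConvex,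
    ProbPowerdomain.ContValuation.isSober.of_retract h.isLinearRetraction.1
      ProbPowerdomain.continuous_dirac h.unit,
    h.isLinearMap, h.isLinearRetraction, ProbPowerdomain.ContValuation.isTopologicalCone,
    ProbPowerdomain.ContValuation.isLocallyLinear, ProbPowerdomain.ContValuation.isSober⟩
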